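/- Let $\Gamma$ be a countable discrete group with identity $e$. A (real) 2-cocycle is a function $\sigma:\Gamma\times\Gamma\to\mathbb{R}$ with $\sigma(a,b)+\sigma(ab,c)=\sigma(a,bc)+\sigma(b,c)$ for all $a,b,c\in\Gamma$; it is normalized if $\sigma(a,e)=\sigma(e,a)=0$ for all $a$; and $H^2(\Gamma,\mathbb{R})$ is the group of 2-cocycles modulo the coboundaries $\partial\gamma(a,b)=\gamma(a)-\gamma(ab)+\gamma(b)$, $\gamma:\Gamma\to\mathbb{R}$. For a normalized 2-cocycle $\omega$ with values in the circle $\mathbb{T}$ (defined by the same identities, written multiplicatively), let $\lambda_\omega(s)$, $s\in\Gamma$, be the unitary operators on $\ell^2(\Gamma)$ given by $\lambda_\omega(s)\delta_t=\omega(s,t)\delta_{st}$. Let $C^*_r(\Gamma,\omega)$ be the norm-closed $*$-algebra generated by $\{\lambda_\omega(s):s\in\Gamma\}$, and let the twisted group von Neumann algebra $L(\Gamma,\omega)$ be its closure in the weak operator topology, with the operator norm. Write $U(L(\Gamma,\omega))$ and $GL(L(\Gamma,\omega))$ for its groups of unitary and of invertible elements. Theorem 1.1. Let $\sigma$ be a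 normalized real 2-cocycle on $\Gamma$ with $[\sigma]\neq0$ in $H^2(\Gamma,\mathbb{R})$. For $n\ge1$ let $\omega_n=e^{2\pi i\sigma/n}$ and let $\rho_n:\Gamma\to U(L(\Gamma,\omega_n))$, $\rho_n(s)=\lambda_{\omega_n}(s)$, be the canonical map. Then there is no sequence of group homomorphisms $\pi_n:\Gamma\to GL(L(\Gamma,\omega_n))$, $n\ge1$, such that $\lim_{n\to\infty}\|\rho_n(s)-\pi_n(s)\|=0$ for every $s\in\Gamma$. -/

import Mathlib

open Filter Topology
open scoped lp ENNReal

noncomputable section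

/-- A normalized 2-cocycle on `Γ` with values in the circle group (trivial action). -/
structure CircleCocycle (Γ : Type*) [Group Γ] where
  toFun : Γ → Γ → Circle
  map_mul' : ∀ a b c, toFun a b * toFun (a * b) c = toFun a (b * c) * toFun b c
  map_one_left' : ∀ a, toFun 1 a = 1
  map_one_right' : ∀ a, toFun a 1 = 1

/-- The group `Z²(Γ, Q)` of 2-cocycles of `Γ` with coefficients in the abelian group `Q`, viewed as
a trivial `Γ`-module. -/
def twoCocycles (Γ Q : Type*) [Group Γ] [AddCommGroup Q] : AddSubgroup (Γ → Γ → Q) where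
  carrier := {σ | ∀ a b c, σ a b + σ (a * b) c = σ a (b * c) + σ b c}
  zero_mem' _ _ _ := rfl
  add_mem' {σ τ} hσ hτ a b c := by
    have h := congrArg₂ (· + ·) (hσ a b c) (hτ a b c)
    simp only [Pi.add_apply]
    rw [add_add_add_comm, h, add_add_add_comm]
  neg_mem' {σ} hσ a b c := by
    simp only [Pi.neg_apply]
    rw [← neg_add, ← neg_add, hσ a b c]

/-- The coboundary map `γ ↦ ∂γ`, `∂γ(a, b) = γ(a) - γ(ab) + γ(b)`. -/
def coboundaryMap (Γ Q : Type*) [Group Γ] [AddCommGroup Q] : (Γ → Q) →+ twoCocycles Γ Q where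
  toFun γ := ⟨fun a b => γ a - γ (a * b) + γ b, fun a b c => by
    dsimp only
    rw [mul_assoc]
    abel⟩
  map_zero' := by
    ext a b
    simp
  map_add' γ δ := by
    ext a b
    simp only [Pi.add_apply, AddSubgroup.coe_add]
    abel

/-- The second cohomology group `H²(Γ, Q)`: the 2-cocycles modulo the 2-coboundaries. -/
abbrev SecondCohomology (Γ Q : Type*) [Group Γ] [AddCommGroup Q] : Type _ :=
  twoCocycles Γ Q ⧸ (coboundaryMap Γ Q).range

/-- The class `[σ] ∈ H²(Γ, Q)` of a 2-cocycle `σ`. -/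
def cohomologyClass {Γ Q : Type*} [Group Γ] [AddCommGroup Q] (σ : twoCocycles Γ Q) :
    SecondCohomology Γ Q :=
  QuotientAddGroup.mk σ

/-- A 2-cocycle is normalized if `σ(a, e) = σ(e, a) = 0` for all `a`. -/
def IsNormalized {Γ Q : Type*} [Group Γ] [AddCommGroup Q] (σ : twoCocycles Γ Q) : Prop :=
  ∀ a : Γ, σ.1 a 1 = 0 ∧ σ.1 1 a = 0

/-- The normalized circle-valued 2-cocycle `(s, t) ↦ e^{2π i θ σ(s, t)}` of a normalized real
2-cocycle `σ` and a real number `θ`. -/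
def CircleCocycle.ofReal {Γ : Type*} [Group Γ] (σ : twoCocycles Γ ℝ) (hσ : IsNormalized σ)
    (θ : ℝ) : CircleCocycle Γ where
  toFun s t := Circle.exp (2 * Real.pi * θ * σ.1 s t)
  map_mul' a b c := by
    have h : σ.1 a b + σ.1 (a * b) c = σ.1 a (b * c) + σ.1 b c := σ.2 a b c
    rw [← Circle.exp_add, ← Circle.exp_add, ← mul_add, ← mul_add, h]
  map_one_left' a := by rw [(hσ a).2, mul_zero, Circle.exp_zero]
  map_one_right' a := by rw [(hσ a).1, mul_zero, Circle.exp_zero]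

namespace TwistedGroup

theorem memℓp_twist {X : Type*} (c : X → Circle) (e : X ≃ X) (f : ℓ²(X, ℂ)) :
    Memℓp (fun x => (c x : ℂ) * f (e x)) 2 := by
  have h := (lp.memℓp f).summable (by norm_num)
  refine memℓp_gen ?_
  simpa [Function.comp_def, norm_mul, Circle.norm_coe] using e.summable_iff.2 h

variable {Γ : Type*} [Group Γ] (ω : CircleCocycle Γ)

/-- The operator `λ_ω(s)` of the left regular `ω`-projective representation of `Γ` on `ℓ²(Γ)`:
`(λ_ω(s) f)(x) = ω(s, s⁻¹x) f(s⁻¹x)`, that is, `λ_ω(s) δ_t = ω(s, t) δ_{st}`. -/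
def leftRegularIsometry (s : Γ) : ℓ²(Γ, ℂ) ≃ₗᵢ[ℂ] ℓ²(Γ, ℂ) where
  toFun f := ⟨fun x => (ω.toFun s (s⁻¹ * x) : ℂ) * f (s⁻¹ * x),
    memℓp_twist (fun x => ω.toFun s (s⁻¹ * x)) (Equiv.mulLeft s⁻¹) f⟩
  invFun f := ⟨fun x => ((ω.toFun s x)⁻¹ : Circle) * f (s * x),
    memℓp_twist (fun x => (ω.toFun s x)⁻¹) (Equiv.mulLeft s) f⟩
  map_add' f g := by
    ext x
    exact mul_add _ _ _
  map_smul' c f := by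
    ext x
    exact mul_left_comm _ _ _
  left_inv f := by
    ext x
    change (((ω.toFun s x)⁻¹ : Circle) : ℂ) *
      ((ω.toFun s (s⁻¹ * (s * x)) : ℂ) * f (s⁻¹ * (s * x))) = f x
    rw [inv_mul_cancel_left, ← mul_assoc, ← Circle.coe_mul, inv_mul_cancel, Circle.coe_one,
      one_mul]
  right_inv f := by
    ext x
    change (ω.toFun s (s⁻¹ * x) : ℂ) *
      ((((ω.toFun s (s⁻¹ * x))⁻¹ : Circle) : ℂ) * f (s * (s⁻¹ * x))) = f x
    rw [mul_inv_cancel_left, ← mul_assoc, ← Circle.coe_mul, mul_inv_cancel, Circle.coe_one,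
      one_mul]
  norm_map' f := by
    have h2 : 0 < (2 : ℝ≥0∞).toReal := by norm_num
    rw [lp.norm_eq_tsum_rpow h2, lp.norm_eq_tsum_rpow h2]
    congr 1
    rw [← (Equiv.mulLeft s⁻¹).tsum_eq (fun x => ‖f x‖ ^ (2 : ℝ≥0∞).toReal)]
    refine tsum_congr fun x => ?_
    change ‖(ω.toFun s (s⁻¹ * x) : ℂ) * f (s⁻¹ * x)‖ ^ _ = ‖f (s⁻¹ * x)‖ ^ _
    rw [norm_mul, Circle.norm_coe, one_mul]

/-- The operator `λ_ω(s)` as a unitary operator on `ℓ²(Γ)`. -/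
def leftRegular (s : Γ) : unitary (ℓ²(Γ, ℂ) →L[ℂ] ℓ²(Γ, ℂ)) :=
  Unitary.linearIsometryEquiv.symm (leftRegularIsometry ω s)

/-- The reduced twisted group C*-algebra `C*_r(Γ, ω)`: the norm closure of the *-algebra generated
by the operators `λ_ω(s)`. -/
def reducedCStarAlgebra : StarSubalgebra ℂ (ℓ²(Γ, ℂ) →L[ℂ] ℓ²(Γ, ℂ)) :=
  (StarAlgebra.adjoin ℂ
    (Set.range fun s => (leftRegular ω s : ℓ²(Γ, ℂ) →L[ℂ] ℓ²(Γ, ℂ)))).topologicalClosure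

/-- The identity map from the bounded operators on a Hilbert space with the norm topology to the
bounded operators with the weak operator topology, as a *-homomorphism. -/
def toWOT (H : Type*) [NormedAddCommGroup H] [InnerProductSpace ℂ H] [CompleteSpace H] :
    (H →L[ℂ] H) →⋆ₐ[ℂ] (H →WOT[ℂ] H) where
  toFun := ContinuousLinearMapWOT.ofCLM
  map_one' := rfl
  map_mul' _ _ := rfl
  map_zero' := rfl
  map_add' _ _ := rfl
  commutes' _ := rfl
  map_star' _ := rfl

/-- The twisted group von Neumann algebra `L(Γ, ω)`: the closure of `C*_r(Γ, ω)` in the weak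
operator topology, as a *-subalgebra of the bounded operators on `ℓ²(Γ)`. It carries the
operator norm. -/
def vonNeumannAlgebra : StarSubalgebra ℂ (ℓ²(Γ, ℂ) →L[ℂ] ℓ²(Γ, ℂ)) :=
  ((reducedCStarAlgebra ω).map (toWOT ℓ²(Γ, ℂ))).topologicalClosure.comap (toWOT ℓ²(Γ, ℂ))

theorem leftRegular_mem (s : Γ) :
    (leftRegular ω s : ℓ²(Γ, ℂ) →L[ℂ] ℓ²(Γ, ℂ)) ∈ vonNeumannAlgebra ω :=
  StarSubalgebra.le_topologicalClosure _
    ⟨_, StarSubalgebra.le_topologicalClosure _ (StarAlgebra.subset_adjoin ℂ _ ⟨s, rfl⟩), rfl⟩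

/-- The canonical map `Γ → U(L(Γ, ω))`, `s ↦ λ_ω(s)`. -/
def canonicalMap (s : Γ) : unitary (vonNeumannAlgebra ω) :=
  ⟨⟨leftRegular ω s, leftRegular_mem ω s⟩,
    Unitary.mem_iff.2 ⟨Subtype.ext (Unitary.mem_iff.1 (leftRegular ω s).2).1,
      Subtype.ext (Unitary.mem_iff.1 (leftRegular ω s).2).2⟩⟩

end TwistedGroup

end

/-!
The proof is a determinant argument. The vector state at `δ_e` is a trace `τ` on `L(Γ, ω)`, and near
the identity of a Banach algebra with a tracial functional, `a ↦ τ(log a)` (`traceLog`) turns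
products into sums (`traceLog_mul`): by cyclicity of `τ`, the derivative of `τ(log a)` along a path
is `τ(a⁻¹ a')` (`hasDerivAt_traceLog`), and this logarithmic derivative is additive in products.

Let `π : Γ → GL(L(Γ, ω))` be a homomorphism that is close to `λ_ω` at `s` and `t`, and let
`d(s) = τ(log(π(s) λ_ω(s)⁻¹))`. As `λ_ω(s) λ_ω(t) = ω(s, t) λ_ω(st)`, additivity and the invariance
of `τ ∘ log` under conjugation give `d(st) = d(s) + d(t) + log ω(s, t)` (`logDefect_mul`). For
`ω = e^{2π i σ/n}` with `n` large, `log ω(s, t) = 2π i σ(s, t)/n`, so the imaginary part of `d`,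
divided by `-2π/n`, is a `γ` with `∂γ = σ` at `(s, t)`. Pointwise convergence on `Γ` thus makes `σ`
a coboundary on each finite set of pairs. Since `∂γ = σ` is a linear system over a field, its
solvability on finite sets implies its solvability (`exists_coboundaryMap_eq_of_forall_finset`),
contradicting `[σ] ≠ 0`.
-/

/-! ### The trace of the logarithm in a Banach algebra -/

section TraceLog

variable {A : Type*} [NormedRing A] [NormedAlgebra ℂ A]

/-- The number `τ(log a)` for a continuous linear functional `τ` and `a` within distance less than
`1` of `1`, where `log a` is the power series `∑ (-1)^k (a - 1)^(k+1) / (k+1)`. -/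
noncomputable def traceLog (τ : A →L[ℂ] ℂ) (a : A) : ℂ :=
  ∑' k : ℕ, (-1) ^ k * τ ((a - 1) ^ (k + 1)) / (k + 1)

@[simp]
theorem traceLog_one (τ : A →L[ℂ] ℂ) : traceLog τ 1 = 0 := by
  simp [traceLog]

theorem traceLog_units_conj {τ : A →L[ℂ] ℂ} (hτ : ∀ a b, τ (a * b) = τ (b * a)) (u : Aˣ) (a : A) :
    traceLog τ (u * a * ↑u⁻¹) = traceLog τ a := by
  have h : (u * a * ↑u⁻¹ - 1 : A) = u * (a - 1) * ↑u⁻¹ := by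
    rw [mul_sub, sub_mul, mul_one, Units.mul_inv]
  unfold traceLog
  refine tsum_congr fun k => ?_
  rw [h, Units.conj_pow, hτ, Units.inv_mul_cancel_left]

theorem traceLog_algebraMap (τ : A →L[ℂ] ℂ) {z : ℂ} (hz : ‖z - 1‖ < 1) :
    traceLog τ (algebraMap ℂ A z) = Complex.log z * τ 1 := by
  have h := (hasSum_nat_add_iff' 1).2 (Complex.hasSum_taylorSeries_log hz)
  rw [add_sub_cancel] at h
  have h' := (h.mul_right (τ 1)).tsum_eq
  simp only [Finset.range_one, Finset.sum_singleton, Nat.cast_zero, div_zero, sub_zero] at h'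
  rw [← h', traceLog]
  refine tsum_congr fun k => ?_
  have hk : (algebraMap ℂ A z - 1) ^ (k + 1) = (z - 1) ^ (k + 1) • (1 : A) := by
    rw [← Algebra.algebraMap_eq_smul_one, map_pow, map_sub, map_one]
  rw [hk, map_smul, smul_eq_mul]
  push_cast
  ring

variable [NormOneClass A] [CompleteSpace A]

/-- The derivative of `τ(log a)` along a differentiable path `a = 1 + c` is `τ(a⁻¹ a')`, as in the
commutative case: cyclicity of `τ` makes the terms of the derivative of `c^(k+1)` equal. -/
theorem hasDerivAt_traceLog {τ : A →L[ℂ] ℂ} (hτ : ∀ a b, τ (a * b) = τ (b * a))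
    {c c' : ℂ → A} {U : Set ℂ} (hU : IsOpen U) (hU' : IsPreconnected U) {r M : ℝ} (hr : r < 1)
    (hc : ∀ z ∈ U, HasDerivAt c (c' z) z) (hcr : ∀ z ∈ U, ‖c z‖ ≤ r) (hcM : ∀ z ∈ U, ‖c' z‖ ≤ M)
    {z₀ : ℂ} (hz₀ : z₀ ∈ U) (hc₀ : c z₀ = 0) {z : ℂ} (hz : z ∈ U) :
    HasDerivAt (fun z => traceLog τ (1 + c z)) (τ ((∑' k : ℕ, (-c z) ^ k) * c' z)) z := by
  have hr0 : 0 ≤ r := (norm_nonneg _).trans (hcr z₀ hz₀)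
  have hsum : (∑' k : ℕ, τ ((-c z) ^ k * c' z)) = τ ((∑' k : ℕ, (-c z) ^ k) * c' z) := by
    have hs : Summable fun k : ℕ => (-c z) ^ k :=
      summable_geometric_of_norm_lt_one (by rw [norm_neg]; exact (hcr z hz).trans_lt hr)
    rw [← hs.tsum_mul_right, τ.map_tsum (hs.mul_right (c' z))]
  rw [← hsum]
  simp only [traceLog, add_sub_cancel_left]
  refine hasDerivAt_tsum_of_isPreconnected (u := fun k : ℕ => ‖τ‖ * (r ^ k * M))
    (g := fun (k : ℕ) z => (-1) ^ k * τ (c z ^ (k + 1)) / (k + 1))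
    (g' := fun (k : ℕ) z => τ ((-c z) ^ k * c' z))
    (((summable_geometric_of_lt_one hr0 hr).mul_right M).mul_left ‖τ‖) hU hU' ?_ ?_ hz₀ ?_ hz
  · intro k y hy
    have h : HasDerivAt (fun y => τ (c y ^ (k + 1)))
        (τ (∑ i ∈ Finset.range (k + 1), c y ^ ((k + 1).pred - i) * c' y * c y ^ i)) y :=
      τ.hasFDerivAt.comp_hasDerivAt y ((hc y hy).fun_pow' (k + 1))
    have h2 := (h.const_mul ((-1 : ℂ) ^ k)).div_const ((k : ℂ) + 1)
    refine h2.congr_deriv ?_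
    have hterm : ∀ i ∈ Finset.range (k + 1),
        τ (c y ^ ((k + 1).pred - i) * c' y * c y ^ i) = τ (c y ^ k * c' y) := by
      intro i hi
      have hik : i + (k - i) = k := by have := Finset.mem_range.1 hi; omega
      rw [hτ, ← mul_assoc, ← pow_add, Nat.pred_succ, hik]
    have hneg : (-c y) ^ k * c' y = (-1 : ℂ) ^ k • (c y ^ k * c' y) := by
      rw [← neg_one_smul ℂ (c y), smul_pow, smul_mul_assoc]
    rw [map_sum, Finset.sum_congr rfl hterm, Finset.sum_const, Finset.card_range, nsmul_eq_mul,
      hneg, map_smul, smul_eq_mul]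
    have hk : (k : ℂ) + 1 ≠ 0 := by exact_mod_cast k.succ_ne_zero
    push_cast
    field_simp
  · intro k y hy
    refine (τ.le_opNorm _).trans ?_
    gcongr
    refine (norm_mul_le _ _).trans ?_
    gcongr
    · exact (norm_pow_le _ _).trans (by rw [norm_neg]; gcongr; exact hcr y hy)
    · exact hcM y hy
  · simp [hc₀, summable_zero]

/-- Near `1`, the function `τ ∘ log` turns products into sums, for a tracial functional `τ`. -/
theorem traceLog_mul {τ : A →L[ℂ] ℂ} (hτ : ∀ a b, τ (a * b) = τ (b * a)) {a b : A}
    (ha : ‖a - 1‖ ≤ 1 / 8) (hb : ‖b - 1‖ ≤ 1 / 8) :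
    traceLog τ (a * b) = traceLog τ a + traceLog τ b := by
  obtain ⟨x, rfl⟩ : ∃ x, a = 1 + x := ⟨a - 1, by abel⟩
  obtain ⟨y, rfl⟩ : ∃ y, b = 1 + y := ⟨b - 1, by abel⟩
  rw [add_sub_cancel_left] at ha hb
  -- The derivatives of the two sides along `t ↦ (1 + t x, 1 + t y)` agree on a ball containing `1`.
  set U : Set ℂ := Metric.ball 0 2 with hU
  have hUo : IsOpen U := Metric.isOpen_ball
  have hUc : IsPreconnected U := (convex_ball (0 : ℂ) 2).isPreconnected
  have h0 : (0 : ℂ) ∈ U := by simp [hU]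
  have h1 : (1 : ℂ) ∈ U := by simp [hU]
  have hnorm : ∀ t ∈ U, ‖t‖ ≤ 2 := fun t ht => (mem_ball_zero_iff.1 ht).le
  have hsmul : ∀ v : A, ‖v‖ ≤ 1 / 8 → ∀ t ∈ U, ‖t • v‖ ≤ 1 / 4 := by
    intro v hv t ht
    rw [norm_smul]
    calc ‖t‖ * ‖v‖ ≤ 2 * (1 / 8) := by gcongr; exact hnorm t ht
      _ = 1 / 4 := by norm_num
  have hdsmul : ∀ (v : A) (t : ℂ), HasDerivAt (fun t : ℂ => t • v) v t := fun v t => by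
    simpa using (hasDerivAt_id t).smul_const v
  have hx : ∀ t ∈ U, HasDerivAt (fun t => traceLog τ (1 + t • x))
      (τ ((∑' k : ℕ, (-(t • x)) ^ k) * x)) t := fun t ht =>
    hasDerivAt_traceLog hτ hUo hUc (r := 1 / 4) (M := 1 / 8) (c := fun t : ℂ => t • x)
      (c' := fun _ => x) (by norm_num)
      (fun t _ => hdsmul x t) (hsmul x ha) (fun _ _ => ha) h0 (zero_smul _ _) ht
  have hy : ∀ t ∈ U, HasDerivAt (fun t => traceLog τ (1 + t • y))
      (τ ((∑' k : ℕ, (-(t • y)) ^ k) * y)) t := fun t ht =>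
    hasDerivAt_traceLog hτ hUo hUc (r := 1 / 4) (M := 1 / 8) (c := fun t : ℂ => t • y)
      (c' := fun _ => y) (by norm_num)
      (fun t _ => hdsmul y t) (hsmul y hb) (fun _ _ => hb) h0 (zero_smul _ _) ht
  have hone : ∀ v : A, ‖v‖ ≤ 1 / 8 → ∀ t ∈ U, ‖1 + t • v‖ ≤ 5 / 4 := by
    intro v hv t ht
    refine (norm_add_le _ _).trans ?_
    rw [norm_one]
    linarith [hsmul v hv t ht]
  have hwr : ∀ t ∈ U, ‖t • x + (1 + t • x) * t • y‖ ≤ 9 / 16 := by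
    intro t ht
    have h2 : ‖(1 + t • x) * t • y‖ ≤ 5 / 4 * (1 / 4) :=
      (norm_mul_le _ _).trans (by gcongr; exacts [hone x ha t ht, hsmul y hb t ht])
    refine (norm_add_le _ _).trans ?_
    linarith [hsmul x ha t ht]
  have hwM : ∀ t ∈ U, ‖x * (1 + t • y) + (1 + t • x) * y‖ ≤ 5 / 16 := by
    intro t ht
    have h2 : ‖x * (1 + t • y)‖ ≤ 1 / 8 * (5 / 4) :=
      (norm_mul_le _ _).trans (by gcongr; exact hone y hb t ht)
    have h3 : ‖(1 + t • x) * y‖ ≤ 5 / 4 * (1 / 8) :=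
      (norm_mul_le _ _).trans (by gcongr; exact hone x ha t ht)
    refine (norm_add_le _ _).trans ?_
    linarith
  have hdw : ∀ t ∈ U, HasDerivAt (fun t : ℂ => t • x + (1 + t • x) * t • y)
      (x * (1 + t • y) + (1 + t • x) * y) t := by
    intro t _
    have h := (hdsmul x t).add (((hdsmul x t).const_add 1).mul (hdsmul y t))
    refine h.congr_deriv ?_
    rw [mul_add, mul_one, add_assoc]
  have hw : ∀ t ∈ U, HasDerivAt (fun t => traceLog τ (1 + (t • x + (1 + t • x) * t • y)))
      (τ ((∑' k : ℕ, (-(t • x + (1 + t • x) * t • y)) ^ k) *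
        (x * (1 + t • y) + (1 + t • x) * y))) t := fun t ht =>
    hasDerivAt_traceLog hτ hUo hUc (r := 9 / 16) (M := 5 / 16)
      (c := fun t : ℂ => t • x + (1 + t • x) * t • y)
      (c' := fun t => x * (1 + t • y) + (1 + t • x) * y) (by norm_num)
      hdw hwr hwM h0 (by simp) ht
  have hprod : ∀ t : ℂ, 1 + (t • x + (1 + t • x) * t • y) = (1 + t • x) * (1 + t • y) := fun t => by
    rw [mul_add (1 + t • x), mul_one, add_assoc]
  have hgl : ∀ v : A, ‖v‖ < 1 → (∑' k : ℕ, (-v) ^ k) * (1 + v) = 1 := fun v hv => by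
    simpa using geom_series_mul_neg (-v) (by rwa [norm_neg])
  have hgr : ∀ v : A, ‖v‖ < 1 → (1 + v) * (∑' k : ℕ, (-v) ^ k) = 1 := fun v hv => by
    simpa using mul_neg_geom_series (-v) (by rwa [norm_neg])
  have key : ∀ t ∈ U, τ ((∑' k : ℕ, (-(t • x + (1 + t • x) * t • y)) ^ k) *
        (x * (1 + t • y) + (1 + t • x) * y)) =
      τ ((∑' k : ℕ, (-(t • x)) ^ k) * x) + τ ((∑' k : ℕ, (-(t • y)) ^ k) * y) := by
    intro t ht
    have hx1 : ‖t • x‖ < 1 := (hsmul x ha t ht).trans_lt (by norm_num)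
    have hy1 : ‖t • y‖ < 1 := (hsmul y hb t ht).trans_lt (by norm_num)
    have hw1 := hgl _ ((hwr t ht).trans_lt (by norm_num : (9 / 16 : ℝ) < 1))
    rw [hprod] at hw1
    have hxl := hgl _ hx1
    have hxr := hgr _ hx1
    have hyr := hgr _ hy1
    set X := ∑' k : ℕ, (-(t • x)) ^ k
    set Y := ∑' k : ℕ, (-(t • y)) ^ k
    set W := ∑' k : ℕ, (-(t • x + (1 + t • x) * t • y)) ^ k
    set a := 1 + t • x
    set b := 1 + t • y
    have hW : W = Y * X := by
      calc W = W * (a * (b * Y) * X) := by rw [hyr, mul_one, hxr, mul_one]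
        _ = W * (a * b) * (Y * X) := by simp only [mul_assoc]
        _ = Y * X := by rw [hw1, one_mul]
    have e1 : Y * X * (x * b) = Y * (X * x * b) := by simp only [mul_assoc]
    have e2 : X * x * b * Y = X * x := by rw [mul_assoc, hyr, mul_one]
    have e3 : Y * X * (a * y) = Y * y := by rw [mul_assoc, ← mul_assoc X, hxl, one_mul]
    rw [hW, mul_add, map_add, e1, hτ, e2, e3]
  have hdiff : ∀ t ∈ U, HasDerivAt (fun t => traceLog τ (1 + (t • x + (1 + t • x) * t • y)) -
      (traceLog τ (1 + t • x) + traceLog τ (1 + t • y))) 0 t := by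
    intro t ht
    have h := (hw t ht).sub ((hx t ht).add (hy t ht))
    rwa [key t ht, sub_self] at h
  have hconst := hUo.is_const_of_deriv_eq_zero hUc
    (fun t ht => (hdiff t ht).differentiableAt.differentiableWithinAt)
    (fun t ht => (hdiff t ht).deriv) h1 h0
  have hprod1 : 1 + (x + (1 + x) * y) = (1 + x) * (1 + y) := by simpa using hprod 1
  simp only [one_smul, zero_smul, mul_zero, add_zero, traceLog_one, sub_zero, hprod1] at hconst
  exact sub_eq_zero.1 hconst

end TraceLog

/-! ### Coboundaries and finite subsystems -/

/-- A linear system over a field all of whose finite subsystems are solvable is solvable; here for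
the system `∂γ = σ`. -/
theorem exists_coboundaryMap_eq_of_forall_finset {Γ K : Type*} [Group Γ] [Field K]
    (σ : twoCocycles Γ K)
    (h : ∀ F : Finset (Γ × Γ), ∃ γ : Γ → K, ∀ p ∈ F,
      γ p.1 - γ (p.1 * p.2) + γ p.2 = σ.1 p.1 p.2) :
    ∃ γ : Γ → K, coboundaryMap Γ K γ = σ := by
  -- `d` is the boundary map on the finitely supported 2-chains, whose transpose is `∂`.
  let d : (Γ × Γ →₀ K) →ₗ[K] (Γ →₀ K) := Finsupp.linearCombination K fun p =>
    Finsupp.single p.1 1 - Finsupp.single (p.1 * p.2) 1 + Finsupp.single p.2 1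
  let φ : Module.Dual K (Γ × Γ →₀ K) := Finsupp.linearCombination K fun p => σ.1 p.1 p.2
  have hφ : φ ∈ (LinearMap.ker d).dualAnnihilator := by
    rw [Submodule.mem_dualAnnihilator]
    intro x hx
    obtain ⟨γ, hγ⟩ := h x.support
    have hd : Finsupp.linearCombination K γ (d x) = φ x := by
      have hdx : d x = ∑ p ∈ x.support, x p • (Finsupp.single p.1 (1 : K) -
        Finsupp.single (p.1 * p.2) 1 + Finsupp.single p.2 1) := Finsupp.linearCombination_apply _ _
      have hφx : φ x = ∑ p ∈ x.support, x p • σ.1 p.1 p.2 := Finsupp.linearCombination_apply _ _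
      rw [hdx, hφx, map_sum]
      refine Finset.sum_congr rfl fun p hp => ?_
      rw [← hγ p hp]
      simp only [map_smul, map_add, map_sub, Finsupp.linearCombination_single, one_smul]
    rw [← hd, LinearMap.mem_ker.1 hx, map_zero]
  rw [← LinearMap.range_dualMap_eq_dualAnnihilator_ker] at hφ
  obtain ⟨g, hg⟩ := hφ
  refine ⟨fun s => g (Finsupp.single s 1), Subtype.ext (funext₂ fun a b => ?_)⟩
  have := LinearMap.congr_fun hg (Finsupp.single (a, b) 1)
  simpa [d, φ, coboundaryMap] using this

/-! ### The trace of the twisted group von Neumann algebra -/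

namespace TwistedGroup

variable {Γ : Type*} [Group Γ] (ω : CircleCocycle Γ)

theorem leftRegular_apply (s : Γ) (f : ℓ²(Γ, ℂ)) (x : Γ) :
    (leftRegular ω s : ℓ²(Γ, ℂ) →L[ℂ] ℓ²(Γ, ℂ)) f x = (ω.toFun s (s⁻¹ * x) : ℂ) * f (s⁻¹ * x) :=
  rfl

theorem leftRegular_mul (s t : Γ) :
    (leftRegular ω s * leftRegular ω t : ℓ²(Γ, ℂ) →L[ℂ] ℓ²(Γ, ℂ)) =
      (ω.toFun s t : ℂ) • (leftRegular ω (s * t) : ℓ²(Γ, ℂ) →L[ℂ] ℓ²(Γ, ℂ)) := by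
  ext f x
  have h := congrArg (Circle.coeHom) (ω.map_mul' s t (t⁻¹ * (s⁻¹ * x)))
  simp only [map_mul, mul_inv_cancel_left] at h
  change (ω.toFun s (s⁻¹ * x) : ℂ) * ((ω.toFun t (t⁻¹ * (s⁻¹ * x)) : ℂ) * f (t⁻¹ * (s⁻¹ * x))) =
    (ω.toFun s t : ℂ) * ((ω.toFun (s * t) ((s * t)⁻¹ * x) : ℂ) * f ((s * t)⁻¹ * x))
  rw [mul_inv_rev, mul_assoc t⁻¹, ← mul_assoc (ω.toFun s (s⁻¹ * x) : ℂ),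
    ← mul_assoc (ω.toFun s t : ℂ)]
  exact congrArg (· * f (t⁻¹ * (s⁻¹ * x))) h.symm

theorem leftRegular_one : (leftRegular ω (1 : Γ) : ℓ²(Γ, ℂ) →L[ℂ] ℓ²(Γ, ℂ)) = 1 := by
  ext f x
  change (ω.toFun 1 (1⁻¹ * x) : ℂ) * f (1⁻¹ * x) = f x
  rw [ω.map_one_left', Circle.coe_one, inv_one, one_mul, one_mul]

theorem toFun_inv_right (s : Γ) : ω.toFun s s⁻¹ = ω.toFun s⁻¹ s := by
  have h := ω.map_mul' s s⁻¹ s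
  rwa [mul_inv_cancel, inv_mul_cancel, ω.map_one_left', ω.map_one_right', mul_one, one_mul] at h

theorem star_leftRegular (s : Γ) :
    star (leftRegular ω s : ℓ²(Γ, ℂ) →L[ℂ] ℓ²(Γ, ℂ)) =
      (((ω.toFun s s⁻¹)⁻¹ : Circle) : ℂ) •
        (leftRegular ω s⁻¹ : ℓ²(Γ, ℂ) →L[ℂ] ℓ²(Γ, ℂ)) := by
  have h := leftRegular_mul ω s s⁻¹
  rw [mul_inv_cancel, leftRegular_one] at h
  have h2 := congrArg (fun a => (((ω.toFun s s⁻¹)⁻¹ : Circle) : ℂ) •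
    (star (leftRegular ω s : ℓ²(Γ, ℂ) →L[ℂ] ℓ²(Γ, ℂ)) * a)) h
  simp only [← mul_assoc, (Unitary.mem_iff.1 (leftRegular ω s).2).1, one_mul, mul_smul_comm,
    smul_smul, mul_one, ← Circle.coe_mul, inv_mul_cancel, Circle.coe_one, one_smul] at h2
  exact h2.symm

/-- The *-algebra generated by the operators `λ_ω(s)` is their linear span. -/
theorem mem_span_of_mem_adjoin {a : ℓ²(Γ, ℂ) →L[ℂ] ℓ²(Γ, ℂ)}
    (ha : a ∈ StarAlgebra.adjoin ℂ
      (Set.range fun s => (leftRegular ω s : ℓ²(Γ, ℂ) →L[ℂ] ℓ²(Γ, ℂ)))) :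
    a ∈ Submodule.span ℂ
      (Set.range fun s => (leftRegular ω s : ℓ²(Γ, ℂ) →L[ℂ] ℓ²(Γ, ℂ))) := by
  induction ha using StarAlgebra.adjoin_induction with
  | mem x hx => exact Submodule.subset_span hx
  | algebraMap r =>
    rw [Algebra.algebraMap_eq_smul_one, ← leftRegular_one ω]
    exact Submodule.smul_mem _ _ (Submodule.subset_span ⟨1, rfl⟩)
  | add x y _ _ hx hy => exact add_mem hx hy
  | mul x y hx' hy' hx hy =>
    clear hx' hy'
    induction hx, hy using Submodule.span_induction₂ with
    | mem_mem x y hx hy =>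
      obtain ⟨s, rfl⟩ := hx
      obtain ⟨t, rfl⟩ := hy
      simp only [leftRegular_mul]
      exact Submodule.smul_mem _ _ (Submodule.subset_span ⟨s * t, rfl⟩)
    | zero_left y _ => rw [zero_mul]; exact zero_mem _
    | zero_right x _ => rw [mul_zero]; exact zero_mem _
    | add_left x y z _ _ _ h1 h2 => rw [add_mul]; exact add_mem h1 h2
    | add_right x y z _ _ _ h1 h2 => rw [mul_add]; exact add_mem h1 h2
    | smul_left r x y _ _ h => rw [smul_mul_assoc]; exact Submodule.smul_mem _ _ h
    | smul_right r x y _ _ h => rw [mul_smul_comm]; exact Submodule.smul_mem _ _ h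
  | star x hx' hx =>
    clear hx'
    induction hx using Submodule.span_induction with
    | mem x hx =>
      obtain ⟨s, rfl⟩ := hx
      simp only [star_leftRegular]
      exact Submodule.smul_mem _ _ (Submodule.subset_span ⟨s⁻¹, rfl⟩)
    | zero => rw [star_zero]; exact zero_mem _
    | add x y _ _ h1 h2 => rw [star_add]; exact add_mem h1 h2
    | smul r x _ h => rw [star_smul]; exact Submodule.smul_mem _ _ h

open Classical in
/-- The vector `δ_e` of `ℓ²(Γ)`. -/
noncomputable def deltaOne (Γ : Type*) [Group Γ] : ℓ²(Γ, ℂ) :=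
  lp.single 2 (1 : Γ) (1 : ℂ)

/-- The functional `a ↦ ⟨δ_e, a δ_e⟩` on the bounded operators on `ℓ²(Γ)`. -/
noncomputable def vectorState (Γ : Type*) [Group Γ] :
    (ℓ²(Γ, ℂ) →L[ℂ] ℓ²(Γ, ℂ)) →L[ℂ] ℂ :=
  (innerSL ℂ (deltaOne Γ)).comp (ContinuousLinearMap.apply ℂ ℓ²(Γ, ℂ) (deltaOne Γ))

theorem vectorState_apply (a : ℓ²(Γ, ℂ) →L[ℂ] ℓ²(Γ, ℂ)) :
    vectorState Γ a = inner ℂ (deltaOne Γ) (a (deltaOne Γ)) :=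
  rfl

open Classical in
theorem deltaOne_apply (x : Γ) : deltaOne Γ x = if x = 1 then 1 else 0 := by
  rw [deltaOne, lp.single_apply, Pi.single_apply]

open Classical in
theorem vectorState_leftRegular (s : Γ) :
    vectorState Γ (leftRegular ω s) = if s = 1 then 1 else 0 := by
  have h : vectorState Γ (leftRegular ω s) =
      (leftRegular ω s : ℓ²(Γ, ℂ) →L[ℂ] ℓ²(Γ, ℂ)) (deltaOne Γ) 1 := by
    rw [vectorState_apply, deltaOne, lp.inner_single_left]
    simp
  rw [h, leftRegular_apply, deltaOne_apply]
  by_cases hs : s = 1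
  · subst hs
    simp [ω.map_one_left']
  · simp [hs]

theorem vectorState_one : vectorState Γ (1 : ℓ²(Γ, ℂ) →L[ℂ] ℓ²(Γ, ℂ)) = 1 := by
  classical
  rw [vectorState_apply, one_apply_eq_self, deltaOne, lp.inner_single_left]
  simp

theorem vectorState_mul_comm_of_mem_span {a b : ℓ²(Γ, ℂ) →L[ℂ] ℓ²(Γ, ℂ)}
    (ha : a ∈ Submodule.span ℂ
      (Set.range fun s => (leftRegular ω s : ℓ²(Γ, ℂ) →L[ℂ] ℓ²(Γ, ℂ))))
    (hb : b ∈ Submodule.span ℂ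
      (Set.range fun s => (leftRegular ω s : ℓ²(Γ, ℂ) →L[ℂ] ℓ²(Γ, ℂ)))) :
    vectorState Γ (a * b) = vectorState Γ (b * a) := by
  induction ha, hb using Submodule.span_induction₂ with
  | mem_mem x y hx hy =>
    obtain ⟨s, rfl⟩ := hx
    obtain ⟨t, rfl⟩ := hy
    simp only [leftRegular_mul, map_smul, vectorState_leftRegular]
    by_cases h : s * t = 1
    · obtain rfl := eq_inv_of_mul_eq_one_right h
      simp [toFun_inv_right]
    · have h' : t * s ≠ 1 := fun e => h (mul_eq_one_comm.1 e)
      simp [h, h']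
  | zero_left y _ => rw [zero_mul, mul_zero]
  | zero_right x _ => rw [zero_mul, mul_zero]
  | add_left x y z _ _ _ h1 h2 => rw [add_mul, mul_add, map_add, map_add, h1, h2]
  | add_right x y z _ _ _ h1 h2 => rw [add_mul, mul_add, map_add, map_add, h1, h2]
  | smul_left r x y _ _ h => rw [smul_mul_assoc, mul_smul_comm, map_smul, map_smul, h]
  | smul_right r x y _ _ h => rw [smul_mul_assoc, mul_smul_comm, map_smul, map_smul, h]

theorem continuous_toWOT (H : Type*) [NormedAddCommGroup H] [InnerProductSpace ℂ H]
    [CompleteSpace H] : Continuous (toWOT H) :=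
  ContinuousLinearMapWOT.continuous_ofCLM

/-- A property of operators that is closed in the weak operator topology holds on `L(Γ, ω)` as soon
as it holds on the *-algebra generated by the operators `λ_ω(s)`. -/
theorem vonNeumannAlgebra_subset {S : Set (ℓ²(Γ, ℂ) →WOT[ℂ] ℓ²(Γ, ℂ))} (hS : IsClosed S)
    (h : ∀ a ∈ StarAlgebra.adjoin ℂ
      (Set.range fun s => (leftRegular ω s : ℓ²(Γ, ℂ) →L[ℂ] ℓ²(Γ, ℂ))),
      toWOT ℓ²(Γ, ℂ) a ∈ S)
    {a : ℓ²(Γ, ℂ) →L[ℂ] ℓ²(Γ, ℂ)} (ha : a ∈ vonNeumannAlgebra ω) : toWOT ℓ²(Γ, ℂ) a ∈ S := by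
  have hred : ∀ a ∈ reducedCStarAlgebra ω, toWOT ℓ²(Γ, ℂ) a ∈ S := fun a ha =>
    closure_minimal (t := toWOT ℓ²(Γ, ℂ) ⁻¹' S) h (hS.preimage (continuous_toWOT _)) ha
  refine closure_minimal ?_ hS ha
  rintro _ ⟨b, hb, rfl⟩
  exact hred b hb

/-- For fixed `b`, the operators `a` with `τ(ab) = τ(ba)` form a closed set in the weak operator
topology: `τ(ba) = ⟨b* δ_e, a δ_e⟩`. -/
theorem isClosed_setOf_vectorState_mul_comm (b : ℓ²(Γ, ℂ) →L[ℂ] ℓ²(Γ, ℂ)) :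
    IsClosed {a : ℓ²(Γ, ℂ) →WOT[ℂ] ℓ²(Γ, ℂ) |
      vectorState Γ (a.toCLM * b) = vectorState Γ (b * a.toCLM)} := by
  have h1 : Continuous fun a : ℓ²(Γ, ℂ) →WOT[ℂ] ℓ²(Γ, ℂ) => vectorState Γ (a.toCLM * b) :=
    ContinuousLinearMapWOT.continuous_inner_apply continuous_id (b (deltaOne Γ)) (deltaOne Γ)
  have h2 : Continuous fun a : ℓ²(Γ, ℂ) →WOT[ℂ] ℓ²(Γ, ℂ) => vectorState Γ (b * a.toCLM) := by
    have h := ContinuousLinearMapWOT.continuous_inner_apply (𝕜 := ℂ) (E := ℓ²(Γ, ℂ)) continuous_id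
      (deltaOne Γ) (ContinuousLinearMap.adjoint b (deltaOne Γ))
    simp only [ContinuousLinearMap.adjoint_inner_left] at h
    exact h
  exact isClosed_eq h1 h2

/-- The vector state at `δ_e` is a trace on `L(Γ, ω)`. -/
theorem vectorState_mul_comm {a b : ℓ²(Γ, ℂ) →L[ℂ] ℓ²(Γ, ℂ)} (ha : a ∈ vonNeumannAlgebra ω)
    (hb : b ∈ vonNeumannAlgebra ω) : vectorState Γ (a * b) = vectorState Γ (b * a) := by
  have h : ∀ b ∈ StarAlgebra.adjoin ℂ
      (Set.range fun s => (leftRegular ω s : ℓ²(Γ, ℂ) →L[ℂ] ℓ²(Γ, ℂ))),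
      vectorState Γ (a * b) = vectorState Γ (b * a) := fun b hb =>
    vonNeumannAlgebra_subset ω (isClosed_setOf_vectorState_mul_comm b) (fun c hc =>
      vectorState_mul_comm_of_mem_span ω (mem_span_of_mem_adjoin ω hc)
        (mem_span_of_mem_adjoin ω hb)) ha
  exact (vonNeumannAlgebra_subset ω (isClosed_setOf_vectorState_mul_comm a)
    (fun c hc => (h c hc).symm) hb).symm

instance : CompleteSpace (vonNeumannAlgebra ω) := by
  have h : IsClosed (vonNeumannAlgebra ω : Set (ℓ²(Γ, ℂ) →L[ℂ] ℓ²(Γ, ℂ))) :=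
    (StarSubalgebra.isClosed_topologicalClosure _).preimage (continuous_toWOT _)
  exact h.completeSpace_coe

instance : Nontrivial ℓ²(Γ, ℂ) := by
  refine ⟨deltaOne Γ, 0, fun h => ?_⟩
  have := congrArg (fun f : ℓ²(Γ, ℂ) => f 1) h
  simp [deltaOne_apply] at this

instance : NormOneClass (vonNeumannAlgebra ω) :=
  ⟨norm_one (α := ℓ²(Γ, ℂ) →L[ℂ] ℓ²(Γ, ℂ))⟩

/-- The canonical trace `a ↦ ⟨δ_e, a δ_e⟩` of `L(Γ, ω)`. -/
noncomputable def trace : vonNeumannAlgebra ω →L[ℂ] ℂ :=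
  (vectorState Γ).comp (vonNeumannAlgebra ω).toSubalgebra.toSubmodule.subtypeL

theorem trace_mul_comm (a b : vonNeumannAlgebra ω) : trace ω (a * b) = trace ω (b * a) :=
  vectorState_mul_comm ω a.2 b.2

theorem trace_one : trace ω 1 = 1 :=
  vectorState_one

theorem canonicalMap_mul (s t : Γ) :
    (canonicalMap ω s * canonicalMap ω t : vonNeumannAlgebra ω) =
      (ω.toFun s t : ℂ) • (canonicalMap ω (s * t) : vonNeumannAlgebra ω) :=
  Subtype.ext (leftRegular_mul ω s t)

end TwistedGroup

/-! ### Almost representations close to the twisted regular representation -/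

/-- If `u v = z w` for isometric units `u, v, w` and `p q = r` for units `p, q, r` close to them,
then `τ ∘ log` of the quotients `p u⁻¹`, `q v⁻¹`, `r w⁻¹` is multiplicative up to `log z`. -/
theorem traceLog_cocycle {A : Type*} [NormedRing A] [NormedAlgebra ℂ A] [NormOneClass A]
    [CompleteSpace A] {τ : A →L[ℂ] ℂ} (hτ : ∀ a b, τ (a * b) = τ (b * a)) (hτ1 : τ 1 = 1)
    {u v w p q r : Aˣ} {z : ℂ} (huv : (u * v : A) = z • (w : A)) (hpq : p * q = r)
    (hu : ‖(u : A)‖ ≤ 1) (hu' : ‖(↑u⁻¹ : A)‖ ≤ 1) (hp : ‖(p * ↑u⁻¹ - 1 : A)‖ ≤ 1 / 32)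
    (hq : ‖(q * ↑v⁻¹ - 1 : A)‖ ≤ 1 / 32) (hz : ‖z - 1‖ ≤ 1 / 16) :
    traceLog τ (r * ↑w⁻¹ : A) =
      traceLog τ (p * ↑u⁻¹ : A) + traceLog τ (q * ↑v⁻¹ : A) + Complex.log z := by
  have hw : (↑w⁻¹ : A) = z • (↑v⁻¹ * ↑u⁻¹ : A) := by
    calc (↑w⁻¹ : A) = ↑w⁻¹ * (u * v * (↑v⁻¹ * ↑u⁻¹)) := by simp [mul_assoc]
      _ = z • (↑v⁻¹ * ↑u⁻¹ : A) := by rw [huv, smul_mul_assoc, mul_smul_comm,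
            Units.inv_mul_cancel_left]
  -- `r w⁻¹` is `z p u⁻¹` times a conjugate of `q v⁻¹`.
  have hfac : (r * ↑w⁻¹ : A) =
      algebraMap ℂ A z * (p * ↑u⁻¹) * (u * (q * ↑v⁻¹) * ↑u⁻¹) := by
    rw [hw, ← hpq, ← Algebra.smul_def, smul_mul_assoc, mul_smul_comm, Units.val_mul]
    simp only [mul_assoc, Units.inv_mul_cancel_left]
  have hzA : ‖algebraMap ℂ A z - 1‖ ≤ 1 / 16 := by
    rwa [← map_one (algebraMap ℂ A), ← map_sub, norm_algebraMap']
  have hconj : ‖(u * (q * ↑v⁻¹) * ↑u⁻¹ - 1 : A)‖ ≤ 1 / 8 := by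
    have h : (u * (q * ↑v⁻¹) * ↑u⁻¹ - 1 : A) = u * (q * ↑v⁻¹ - 1) * ↑u⁻¹ := by
      rw [mul_sub, sub_mul, mul_one, Units.mul_inv]
    rw [h]
    calc ‖(u * (q * ↑v⁻¹ - 1) * ↑u⁻¹ : A)‖ ≤ ‖(u : A)‖ * ‖(q * ↑v⁻¹ - 1 : A)‖ * ‖(↑u⁻¹ : A)‖ :=
          (norm_mul_le _ _).trans (by gcongr; exact norm_mul_le _ _)
      _ ≤ 1 * (1 / 32) * 1 := by gcongr
      _ ≤ 1 / 8 := by norm_num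
  have hzp : ‖algebraMap ℂ A z * (p * ↑u⁻¹) - 1‖ ≤ 1 / 8 := by
    have h : algebraMap ℂ A z * (p * ↑u⁻¹) - 1 =
        (algebraMap ℂ A z - 1) * (p * ↑u⁻¹ - 1) + (algebraMap ℂ A z - 1) + (p * ↑u⁻¹ - 1) := by
      noncomm_ring
    rw [h]
    have h2 : ‖(algebraMap ℂ A z - 1) * (p * ↑u⁻¹ - 1)‖ ≤ 1 / 16 * (1 / 32) :=
      (norm_mul_le _ _).trans (by gcongr)
    refine norm_add₃_le.trans ?_
    linarith
  rw [hfac, traceLog_mul hτ hzp hconj, traceLog_units_conj hτ,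
    traceLog_mul hτ (hzA.trans (by norm_num)) (hp.trans (by norm_num)),
    traceLog_algebraMap τ (hz.trans_lt (by norm_num)), hτ1]
  ring

namespace TwistedGroup

variable {Γ : Type*} [Group Γ] (ω : CircleCocycle Γ)

theorem norm_canonicalMap (s : Γ) : ‖(canonicalMap ω s : vonNeumannAlgebra ω)‖ ≤ 1 :=
  (CStarRing.norm_coe_unitary (leftRegular ω s)).le

theorem norm_star_canonicalMap (s : Γ) :
    ‖(star (canonicalMap ω s) : vonNeumannAlgebra ω)‖ ≤ 1 :=
  (CStarRing.norm_coe_unitary (star (leftRegular ω s))).le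

/-- The defect `τ(log(π(s) λ_ω(s)⁻¹))` between a representation `π` of `Γ` and `λ_ω`. It has this
meaning where `π(s)` is within distance less than `1` of `λ_ω(s)`; elsewhere it is the value of a
series that need not converge. -/
noncomputable def logDefect (π : Γ →* (vonNeumannAlgebra ω)ˣ) (s : Γ) : ℂ :=
  traceLog (trace ω) (π s * ↑(Unitary.toUnits (canonicalMap ω s))⁻¹ : vonNeumannAlgebra ω)

theorem logDefect_mul (π : Γ →* (vonNeumannAlgebra ω)ˣ) {s t : Γ}
    (hs : ‖(canonicalMap ω s : vonNeumannAlgebra ω) - π s‖ ≤ 1 / 32)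
    (ht : ‖(canonicalMap ω t : vonNeumannAlgebra ω) - π t‖ ≤ 1 / 32)
    (hω : ‖(ω.toFun s t : ℂ) - 1‖ ≤ 1 / 16) :
    logDefect ω π (s * t) =
      logDefect ω π s + logDefect ω π t + Complex.log (ω.toFun s t) := by
  have hclose : ∀ s : Γ, ‖(canonicalMap ω s : vonNeumannAlgebra ω) - π s‖ ≤ 1 / 32 →
      ‖(π s * ↑(Unitary.toUnits (canonicalMap ω s))⁻¹ - 1 : vonNeumannAlgebra ω)‖ ≤ 1 / 32 := by
    intro s hs
    have h : (π s * ↑(Unitary.toUnits (canonicalMap ω s))⁻¹ - 1 : vonNeumannAlgebra ω) =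
        (π s - canonicalMap ω s) * ↑(Unitary.toUnits (canonicalMap ω s))⁻¹ := by
      rw [sub_mul]
      congr 1
      exact (Units.mul_inv (Unitary.toUnits (canonicalMap ω s))).symm
    rw [h]
    refine (norm_mul_le _ _).trans ?_
    rw [norm_sub_rev] at hs
    calc _ ≤ (1 / 32 : ℝ) * 1 := by
          gcongr
          exact norm_star_canonicalMap ω s
      _ = 1 / 32 := mul_one _
  exact traceLog_cocycle (trace_mul_comm ω) (trace_one ω)
    (u := Unitary.toUnits (canonicalMap ω s)) (v := Unitary.toUnits (canonicalMap ω t))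
    (w := Unitary.toUnits (canonicalMap ω (s * t))) (canonicalMap_mul ω s t)
    (map_mul π s t).symm (norm_canonicalMap ω s) (norm_star_canonicalMap ω s) (hclose s hs)
    (hclose t ht) hω

end TwistedGroup

open TwistedGroup in
theorem theorem1p1 {Γ : Type*} [Group Γ] [Countable Γ] (σ : twoCocycles Γ ℝ)
    (hσ : IsNormalized σ) (hne : cohomologyClass σ ≠ 0) :
    ¬ ∃ π : ∀ n : ℕ+, Γ →*
        (TwistedGroup.vonNeumannAlgebra (CircleCocycle.ofReal σ hσ (1 / (n : ℝ))))ˣ,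
      ∀ s : Γ, Tendsto
        (fun n : ℕ+ =>
          ‖(TwistedGroup.canonicalMap (CircleCocycle.ofReal σ hσ (1 / (n : ℝ))) s :
              TwistedGroup.vonNeumannAlgebra (CircleCocycle.ofReal σ hσ (1 / (n : ℝ)))) -
            (π n s :
              TwistedGroup.vonNeumannAlgebra (CircleCocycle.ofReal σ hσ (1 / (n : ℝ))))‖)
        atTop (𝓝 0) := by
  rintro ⟨π, hπ⟩
  apply hne
  have hclose : ∀ s : Γ, ∀ᶠ n : ℕ+ in atTop,
      ‖(canonicalMap (CircleCocycle.ofReal σ hσ (1 / (n : ℝ))) s :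
          vonNeumannAlgebra (CircleCocycle.ofReal σ hσ (1 / (n : ℝ)))) - π n s‖ ≤ 1 / 32 :=
    fun s => (hπ s).eventually (eventually_le_nhds (by norm_num))
  have hinv : Tendsto (fun n : ℕ+ => 1 / (n : ℝ)) atTop (𝓝 0) :=
    tendsto_one_div_atTop_nhds_zero_nat.comp tendsto_PNat_val_atTop_atTop
  suffices h : ∃ γ : Γ → ℝ, coboundaryMap Γ ℝ γ = σ from
    (QuotientAddGroup.eq_zero_iff σ).2 h
  apply exists_coboundaryMap_eq_of_forall_finset
  intro F
  have hF : ∀ᶠ n : ℕ+ in atTop, ∀ p ∈ F,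
      (logDefect _ (π n) (p.1 * p.2)).im = (logDefect _ (π n) p.1).im +
        (logDefect _ (π n) p.2).im + 2 * Real.pi * (1 / (n : ℝ)) * σ.1 p.1 p.2 := by
    refine (eventually_all_finset F).2 fun p _ => ?_
    have hθ : Tendsto (fun n : ℕ+ => 2 * Real.pi * (1 / (n : ℝ)) * σ.1 p.1 p.2) atTop (𝓝 0) := by
      simpa using (hinv.const_mul (2 * Real.pi)).mul_const (σ.1 p.1 p.2)
    have hexp : Tendsto (fun n : ℕ+ =>
        ‖((CircleCocycle.ofReal σ hσ (1 / (n : ℝ))).toFun p.1 p.2 : ℂ) - 1‖) atTop (𝓝 0) := by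
      have hcont : Continuous fun θ : ℝ => ‖(Circle.exp θ : ℂ) - 1‖ := by fun_prop
      have h := (hcont.tendsto 0).comp hθ
      rwa [Circle.exp_zero, Circle.coe_one, sub_self, norm_zero] at h
    filter_upwards [hclose p.1, hclose p.2,
      hexp.eventually (eventually_le_nhds (by norm_num : (0 : ℝ) < 1 / 16)),
      hθ.eventually (lt_mem_nhds (neg_lt_zero.2 Real.pi_pos)),
      hθ.eventually (eventually_le_nhds Real.pi_pos)] with n h1 h2 h3 h4 h5
    -- The bounds `-π < 2πσ/n ≤ π` put the exponent in the range of the principal logarithm.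
    have hlog : Complex.log ((CircleCocycle.ofReal σ hσ (1 / (n : ℝ))).toFun p.1 p.2 : ℂ) =
        ((2 * Real.pi * (1 / (n : ℝ)) * σ.1 p.1 p.2 : ℝ) : ℂ) * Complex.I := by
      rw [CircleCocycle.ofReal, Circle.coe_exp, Complex.log_exp] <;>
        rwa [Complex.im_ofReal_mul, Complex.I_im, mul_one]
    have h := congrArg Complex.im (logDefect_mul _ (π n) h1 h2 h3)
    rwa [hlog, Complex.add_im, Complex.add_im, Complex.im_ofReal_mul, Complex.I_im, mul_one] at h
  obtain ⟨n, hn⟩ := hF.exists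
  have hn0 : (n : ℝ) ≠ 0 := by exact_mod_cast n.ne_zero
  refine ⟨fun s => -(n / (2 * Real.pi)) * (logDefect _ (π n) s).im, fun p hp => ?_⟩
  have hpi := Real.pi_ne_zero
  dsimp only
  rw [hn p hp]
  field_simp
  ring
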